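/- Let $K$ be a field and let $E=(E^0,E^1,r,s)$ be a finite directed graph: $E^0$ (vertices) and $E^1$ (edges) are finite sets and $s,r:E^1\to E^0$ are the source and range maps (loops and parallel edges are allowed). Let $L_K(E)$ be its Leavitt path algebra, that is, the associative $K$-algebra generated by $E^0\cup E^1\cup\{e^*: e\in E^1\}$, with identity $1=\sum_{v\in E^0}v$, subject to the relations - $vv=v$ and $vw=0$ for all $v\neq w$ in $E^0$; - $e\,r(e)=s(e)\,e=e$ and $e^*s(e)=r(e)\,e^*=e^*$ for all $e\in E^1$; - $e^*e=r(e)$ and $e^*f=0$ for all $e\neq f$ in $E^1$; - $v=\sum_{e\in E^1,\ s(e)=v}ee^*$ for all $v\in E^0$ with $s^{-1}(v)\neq\varnothing$. A path of degree $n\ge 1$ is a sequence $\alpha=e_1\cdots e_n$ of edges with $r(e_i)=s(e_{i+1})$ for $1\le i<n$, with source $s(e_1)$ and range $r(e_n)$; a vertex $v$ is a path of degree $0$ with source and range $v$; $\alpha^*=e_n^*\cdots e_1^*$ and $v^*=v$. The algebra $L_K(E)$ is $\mathbb Z$-graded, its component of degree $i$ being the $K$-span $A_i$ of the elements $\alpha\beta^*$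 with $\alpha,\beta$ paths of the same range and $\deg\alpha-\deg\beta=i$. A two-sided ideal $I$ is graded if, whenever $y=\sum_i y_i\in I$ (a finite sum) with $y_i\in A_i$, all $y_i\in I$. A set $X\subseteq E^0$ is hereditary if $w\in X$ whenever there is a path from some $v\in X$ to $w$; it is saturated if every $v\in E^0$ with $s^{-1}(v)\ne\varnothing$ and $\{r(e): s(e)=v\}\subseteq X$ lies in $X$. Then $I\mapsto I\cap E^0$ is a bijection from the set of graded two-sided ideals of $L_K(E)$ onto the set of hereditary saturated subsets of $E^0$. The map sending a hereditary saturated set $H$ to the two-sided ideal of $L_K(E)$ generated by $H$ is a bijection in the other direction, and the two maps are inverse to each other. -/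

import Mathlib

/-- A directed graph `E = (E⁰, E¹, r, s)` with vertex set `V = E⁰` and edge set `A = E¹`;
loops and parallel edges are allowed. -/
structure DirGraph (V : Type*) (A : Type*) where
  /-- The source of an edge. -/
  s : A → V
  /-- The range of an edge. -/
  r : A → V

namespace DirGraph

/-- `E.IsPath v μ w`: the list of edges `μ = e₁ ⋯ eₙ` is a path with source `v` and range `w`.
The empty list is the path of degree `0` at a vertex. -/
def IsPath {V A : Type*} (E : DirGraph V A) : V → List A → V → Prop
  | v, [], w => v = w
  | v, e :: μ, w => E.s e = v ∧ IsPath E (E.r e) μ w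

/-- A set of vertices is hereditary if it is closed under passing to ranges of paths
starting in it. -/
def Hereditary {V A : Type*} (E : DirGraph V A) (X : Set V) : Prop :=
  ∀ v w : V, v ∈ X → (∃ μ : List A, E.IsPath v μ w) → w ∈ X

/-- A set of vertices is saturated if it contains every vertex that emits at least one edge
and all of whose edges end in the set. -/
def Saturated {V A : Type*} (E : DirGraph V A) (X : Set V) : Prop :=
  ∀ v : V, (∃ e : A, E.s e = v) → (∀ e : A, E.s e = v → E.r e ∈ X) → v ∈ X

/-- The generators `E⁰ ∪ E¹ ∪ (E¹)*` of the Leavitt path algebra (a disjoint union). -/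
inductive Gen (V : Type*) (A : Type*)
  | vert (v : V) : Gen V A
  | edge (e : A) : Gen V A
  | ghost (e : A) : Gen V A

section Leavitt

open FreeAlgebra

/-- The defining relations of the Leavitt path algebra of a finite graph, inside the free unital
`K`-algebra on `E⁰ ∪ E¹ ∪ (E¹)*`. The relation `one` makes the sum of the vertices the identity:
this sum is the identity of the algebra presented without identity by the other relations,
so that nothing is changed by working with unital algebras. -/
inductive Rel (K : Type*) [Field K] {V A : Type*} [Fintype V] [DecidableEq V] [Fintype A]
    (E : DirGraph V A) : FreeAlgebra K (Gen V A) → FreeAlgebra K (Gen V A) → Prop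
  /-- The identity is the sum of all vertices. -/
  | one : Rel K E (∑ v : V, ι K (Gen.vert v)) 1
  /-- (V) -/
  | vert_self (v : V) :
      Rel K E (ι K (Gen.vert v) * ι K (Gen.vert v)) (ι K (Gen.vert v))
  | vert_ne (v w : V) (h : w ≠ v) :
      Rel K E (ι K (Gen.vert v) * ι K (Gen.vert w)) 0
  /-- (E1) -/
  | edge_range (e : A) :
      Rel K E (ι K (Gen.edge e) * ι K (Gen.vert (E.r e))) (ι K (Gen.edge e))
  | source_edge (e : A) :
      Rel K E (ι K (Gen.vert (E.s e)) * ι K (Gen.edge e)) (ι K (Gen.edge e))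
  /-- (E2) -/
  | ghost_source (e : A) :
      Rel K E (ι K (Gen.ghost e) * ι K (Gen.vert (E.s e))) (ι K (Gen.ghost e))
  | range_ghost (e : A) :
      Rel K E (ι K (Gen.vert (E.r e)) * ι K (Gen.ghost e)) (ι K (Gen.ghost e))
  /-- (CK1) -/
  | ghost_edge_self (e : A) :
      Rel K E (ι K (Gen.ghost e) * ι K (Gen.edge e)) (ι K (Gen.vert (E.r e)))
  | ghost_edge_ne (e f : A) (h : e ≠ f) :
      Rel K E (ι K (Gen.ghost e) * ι K (Gen.edge f)) 0
  /-- (CK2), imposed at the vertices that emit at least one edge -/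
  | vert_eq_sum (v : V) (h : ∃ e : A, E.s e = v) :
      Rel K E (ι K (Gen.vert v))
        (∑ e : A with E.s e = v, ι K (Gen.edge e) * ι K (Gen.ghost e))

end Leavitt

/-- The Leavitt path algebra `L_K(E)` of a finite graph. -/
def LeavittPathAlgebra (K : Type*) [Field K] {V A : Type*} [Fintype V] [DecidableEq V] [Fintype A]
    (E : DirGraph V A) :=
  RingQuot (Rel K E)

namespace LeavittPathAlgebra

noncomputable instance (K : Type*) [Field K] {V A : Type*} [Fintype V] [DecidableEq V]
    [Fintype A] (E : DirGraph V A) : Ring (LeavittPathAlgebra K E) :=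
  inferInstanceAs (Ring (RingQuot (Rel K E)))

noncomputable instance (K : Type*) [Field K] {V A : Type*} [Fintype V] [DecidableEq V]
    [Fintype A] (E : DirGraph V A) : Algebra K (LeavittPathAlgebra K E) :=
  inferInstanceAs (Algebra K (RingQuot (Rel K E)))

section

variable (K : Type*) [Field K] {V A : Type*} [Fintype V] [DecidableEq V] [Fintype A]
  (E : DirGraph V A)

/-- The quotient map from the free algebra. -/
noncomputable def mk : FreeAlgebra K (Gen V A) →ₐ[K] LeavittPathAlgebra K E :=
  RingQuot.mkAlgHom K (Rel K E)

/-- A vertex, as an element of `L_K(E)`. -/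
noncomputable def vert (v : V) : LeavittPathAlgebra K E :=
  mk K E (FreeAlgebra.ι K (Gen.vert v))

/-- An edge `e`, as an element of `L_K(E)`. -/
noncomputable def edge (e : A) : LeavittPathAlgebra K E :=
  mk K E (FreeAlgebra.ι K (Gen.edge e))

/-- A ghost edge `e*`, as an element of `L_K(E)`. -/
noncomputable def ghost (e : A) : LeavittPathAlgebra K E :=
  mk K E (FreeAlgebra.ι K (Gen.ghost e))

/-- The element `α = e₁ ⋯ eₙ` of `L_K(E)` given by a path `α` with source `u`
(it is the vertex `u` if `n = 0`). -/
noncomputable def path (u : V) (α : List A) : LeavittPathAlgebra K E :=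
  vert K E u * (α.map (edge K E)).prod

/-- The element `β* = eₙ* ⋯ e₁*` of `L_K(E)` given by a path `β = e₁ ⋯ eₙ` with source `v`
(it is the vertex `v` if `n = 0`). -/
noncomputable def pathStar (v : V) (β : List A) : LeavittPathAlgebra K E :=
  (β.reverse.map (ghost K E)).prod * vert K E v

/-- The homogeneous component of degree `i` of `L_K(E)`: the span of the elements `αβ*` with
`α`, `β` paths of the same range and `deg α - deg β = i`. -/
noncomputable def component (i : ℤ) : Submodule K (LeavittPathAlgebra K E) :=
  Submodule.span K {x | ∃ (u v w : V) (α β : List A), E.IsPath u α w ∧ E.IsPath v β w ∧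
    (α.length : ℤ) - (β.length : ℤ) = i ∧ x = path K E u α * pathStar K E v β}

variable {K E}

/-- A two-sided ideal is graded if, for each of its elements `y = ∑ᵢ yᵢ` with `yᵢ` homogeneous of
degree `i` (a finite sum), it contains every `yᵢ`. -/
def IsGraded (I : TwoSidedIdeal (LeavittPathAlgebra K E)) : Prop :=
  ∀ y : ℤ →₀ LeavittPathAlgebra K E, (∀ i, y i ∈ component K E i) →
    (y.sum fun _ a => a) ∈ I → ∀ i, y i ∈ I

/-- The set of vertices `I ∩ E⁰` of an ideal. -/
def vertices (I : TwoSidedIdeal (LeavittPathAlgebra K E)) : Set V :=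
  {v | vert K E v ∈ I}

variable (K E)

/-- The two-sided ideal of `L_K(E)` generated by a set of vertices. -/
noncomputable def idealOf (H : Set V) : TwoSidedIdeal (LeavittPathAlgebra K E) :=
  TwoSidedIdeal.span (vert K E '' H)

end

end LeavittPathAlgebra

end DirGraph

/-! ### Paths in a directed graph. -/

namespace DirGraph

/-! The two compositions of the maps are the identity for different reasons.

A graded ideal `I` is determined by its vertices because each homogeneous `x ∈ I` can be cut down to
scalar multiples of vertices and rebuilt from them. Multiplying by `e*` on the left and by `f` on
the right shortens the monomials `αβ*` by (CK1), and (CK2), `v = ∑ ee*`, recovers `x` from these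
products. At sinks (CK2) is missing, but there `x` reduces at once to a multiple of the sink or to
zero. A nonzero multiple of `v` in `I` puts `v` in `I`, since `K` is a field. This is
`mem_of_mem_balanced` in degree 0 and `mem_of_mem_component` in general.

Conversely, the ideal generated by a hereditary saturated `H` contains no further vertex:
`mem_of_vert_mem_idealOf` builds a representation on the functions on `(V \ H) × ℕ` in which exactly
the vertices of `H` act as zero. Heredity and saturation are what make this a branching system. The
ideal is graded (`isGraded_idealOf`) because its generators have degree 0. -/

theorem isPath_nil {V A : Type*} (E : DirGraph V A) (v : V) : E.IsPath v [] v := rfl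

theorem IsPath.cons {V A : Type*} {E : DirGraph V A} {e : A} {α : List A} {w : V}
    (h : E.IsPath (E.r e) α w) : E.IsPath (E.s e) (e :: α) w := ⟨rfl, h⟩

theorem IsPath.concat {V A : Type*} {E : DirGraph V A} {u : V} {α : List A} {e : A}
    (h : E.IsPath u α (E.s e)) : E.IsPath u (α ++ [e]) (E.r e) := by
  induction α generalizing u with
  | nil => exact ⟨h.symm, rfl⟩
  | cons f α ih => exact ⟨h.1, ih h.2⟩

namespace LeavittPathAlgebra

/-! ### The defining relations and the universal property. -/

section Relations

variable (K : Type*) [Field K] {V A : Type*} [Fintype V] [DecidableEq V] [Fintype A]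
  (E : DirGraph V A)

theorem mk_eq_of_rel {x y : FreeAlgebra K (Gen V A)} (h : Rel K E x y) : mk K E x = mk K E y :=
  RingQuot.mkAlgHom_rel K h

theorem sum_vert : ∑ v, vert K E v = 1 := by
  simpa [vert] using mk_eq_of_rel K E Rel.one

theorem vert_mul_self (v : V) : vert K E v * vert K E v = vert K E v := by
  simpa [vert] using mk_eq_of_rel K E (Rel.vert_self v)

theorem vert_mul_vert_of_ne {v w : V} (h : w ≠ v) : vert K E v * vert K E w = 0 := by
  simpa [vert] using mk_eq_of_rel K E (Rel.vert_ne v w h)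

theorem edge_mul_vert_range (e : A) : edge K E e * vert K E (E.r e) = edge K E e := by
  simpa [vert, edge] using mk_eq_of_rel K E (Rel.edge_range e)

theorem vert_source_mul_edge (e : A) : vert K E (E.s e) * edge K E e = edge K E e := by
  simpa [vert, edge] using mk_eq_of_rel K E (Rel.source_edge e)

theorem ghost_mul_vert_source (e : A) : ghost K E e * vert K E (E.s e) = ghost K E e := by
  simpa [vert, ghost] using mk_eq_of_rel K E (Rel.ghost_source e)

theorem vert_range_mul_ghost (e : A) : vert K E (E.r e) * ghost K E e = ghost K E e := by
  simpa [vert, ghost] using mk_eq_of_rel K E (Rel.range_ghost e)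

theorem ghost_mul_edge_self (e : A) : ghost K E e * edge K E e = vert K E (E.r e) := by
  simpa [vert, ghost, edge] using mk_eq_of_rel K E (Rel.ghost_edge_self e)

theorem ghost_mul_edge_of_ne {e f : A} (h : e ≠ f) : ghost K E e * edge K E f = 0 := by
  simpa [ghost, edge] using mk_eq_of_rel K E (Rel.ghost_edge_ne e f h)

theorem vert_eq_sum_edge_mul_ghost (v : V) (h : ∃ e : A, E.s e = v) :
    vert K E v = ∑ e : A with E.s e = v, edge K E e * ghost K E e := by
  simpa [vert, ghost, edge] using mk_eq_of_rel K E (Rel.vert_eq_sum v h)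

/-- The universal property of the Leavitt path algebra. -/
theorem exists_lift {B : Type*} [Ring B] [Algebra K B] (p : V → B) (a b : A → B)
    (one : ∑ v, p v = 1) (vert_self : ∀ v, p v * p v = p v)
    (vert_ne : ∀ v w, w ≠ v → p v * p w = 0)
    (edge_range : ∀ e, a e * p (E.r e) = a e) (source_edge : ∀ e, p (E.s e) * a e = a e)
    (ghost_source : ∀ e, b e * p (E.s e) = b e) (range_ghost : ∀ e, p (E.r e) * b e = b e)
    (ghost_edge_self : ∀ e, b e * a e = p (E.r e))
    (ghost_edge_ne : ∀ e f, e ≠ f → b e * a f = 0)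
    (vert_eq_sum : ∀ v, (∃ e, E.s e = v) → p v = ∑ e : A with E.s e = v, a e * b e) :
    ∃ φ : LeavittPathAlgebra K E →ₐ[K] B, (∀ v, φ (vert K E v) = p v) ∧
      (∀ e, φ (edge K E e) = a e) ∧ ∀ e, φ (ghost K E e) = b e := by
  let g : Gen V A → B := fun x => match x with
    | .vert v => p v
    | .edge e => a e
    | .ghost e => b e
  let F : FreeAlgebra K (Gen V A) →ₐ[K] B := FreeAlgebra.lift K g
  have Fv : ∀ v, F (FreeAlgebra.ι K (Gen.vert v)) = p v := fun v => FreeAlgebra.lift_ι_apply g _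
  have Fe : ∀ e, F (FreeAlgebra.ι K (Gen.edge e)) = a e := fun v => FreeAlgebra.lift_ι_apply g _
  have Fg : ∀ e, F (FreeAlgebra.ι K (Gen.ghost e)) = b e := fun v => FreeAlgebra.lift_ι_apply g _
  have hF : ∀ ⦃x y⦄, Rel K E x y → F x = F y := by
    intro x y h
    induction h with
    | one => simpa [Fv] using one
    | vert_self v => simpa [Fv] using vert_self v
    | vert_ne v w h => simpa [Fv] using vert_ne v w h
    | edge_range e => simpa [Fv, Fe] using edge_range e
    | source_edge e => simpa [Fv, Fe] using source_edge e
    | ghost_source e => simpa [Fv, Fg] using ghost_source e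
    | range_ghost e => simpa [Fv, Fg] using range_ghost e
    | ghost_edge_self e => simpa [Fv, Fe, Fg] using ghost_edge_self e
    | ghost_edge_ne e f h => simpa [Fe, Fg] using ghost_edge_ne e f h
    | vert_eq_sum v h => simpa [Fv, Fe, Fg] using vert_eq_sum v h
  let φ : LeavittPathAlgebra K E →ₐ[K] B := RingQuot.liftAlgHom K ⟨F, hF⟩
  have hφ : ∀ x, φ (mk K E x) = F x := fun x => RingQuot.liftAlgHom_mkAlgHom_apply K F hF x
  exact ⟨φ, fun v => (hφ _).trans (Fv v), fun e => (hφ _).trans (Fe e),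
    fun e => (hφ _).trans (Fg e)⟩

end Relations

/-! ### Multiplication of paths by generators. -/

section Paths

variable (K : Type*) [Field K] {V A : Type*} [Fintype V] [DecidableEq V] [Fintype A]
  (E : DirGraph V A)

theorem path_nil (u : V) : path K E u [] = vert K E u := by simp [path]

theorem pathStar_nil (u : V) : pathStar K E u [] = vert K E u := by simp [pathStar]

theorem vert_mul_path (u : V) (α : List A) : vert K E u * path K E u α = path K E u α := by
  rw [path, ← mul_assoc, vert_mul_self]

theorem vert_mul_path_of_ne {u v : V} (h : u ≠ v) (α : List A) :
    vert K E v * path K E u α = 0 := by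
  rw [path, ← mul_assoc, vert_mul_vert_of_ne K E h, zero_mul]

theorem pathStar_mul_vert (u : V) (α : List A) :
    pathStar K E u α * vert K E u = pathStar K E u α := by
  rw [pathStar, mul_assoc, vert_mul_self]

theorem pathStar_mul_vert_of_ne {u v : V} (h : u ≠ v) (α : List A) :
    pathStar K E u α * vert K E v = 0 := by
  rw [pathStar, mul_assoc, vert_mul_vert_of_ne K E h.symm, mul_zero]

theorem path_cons (e : A) (α : List A) :
    path K E (E.s e) (e :: α) = edge K E e * path K E (E.r e) α := by
  simp only [path, List.map_cons, List.prod_cons, ← mul_assoc, vert_source_mul_edge,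
    edge_mul_vert_range]

theorem pathStar_cons (e : A) (α : List A) :
    pathStar K E (E.s e) (e :: α) = pathStar K E (E.r e) α * ghost K E e := by
  simp [pathStar, mul_assoc, ghost_mul_vert_source, vert_range_mul_ghost]

theorem path_concat (u : V) (α : List A) (e : A) :
    path K E u (α ++ [e]) = path K E u α * edge K E e := by
  simp [path, mul_assoc]

theorem pathStar_concat (u : V) (α : List A) (e : A) :
    pathStar K E u (α ++ [e]) = ghost K E e * pathStar K E u α := by
  simp [pathStar, mul_assoc]

variable {E} in
theorem path_mul_vert {u w : V} {α : List A} (h : E.IsPath u α w) :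
    path K E u α * vert K E w = path K E u α := by
  induction α generalizing u with
  | nil =>
    obtain rfl : u = w := h
    rw [path_nil, vert_mul_self]
  | cons f α ih =>
    obtain ⟨rfl, h⟩ := h
    rw [path_cons, mul_assoc, ih h]

variable {E} in
theorem vert_mul_pathStar {u w : V} {α : List A} (h : E.IsPath u α w) :
    vert K E w * pathStar K E u α = pathStar K E u α := by
  induction α generalizing u with
  | nil =>
    obtain rfl : u = w := h
    rw [pathStar_nil, vert_mul_self]
  | cons f α ih =>
    obtain ⟨rfl, h⟩ := h
    rw [pathStar_cons, ← mul_assoc, ih h]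

theorem ghost_mul_vert_of_ne {u : V} {e : A} (h : E.s e ≠ u) : ghost K E e * vert K E u = 0 := by
  rw [← ghost_mul_vert_source, mul_assoc, vert_mul_vert_of_ne K E h.symm, mul_zero]

theorem vert_mul_edge_of_ne {u : V} {e : A} (h : E.s e ≠ u) : vert K E u * edge K E e = 0 := by
  rw [← vert_source_mul_edge, ← mul_assoc, vert_mul_vert_of_ne K E h, zero_mul]

theorem ghost_mul_path_cons (e : A) (α : List A) :
    ghost K E e * path K E (E.s e) (e :: α) = path K E (E.r e) α := by
  rw [path_cons, ← mul_assoc, ghost_mul_edge_self, vert_mul_path]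

theorem ghost_mul_path_cons_of_ne {e f : A} (h : e ≠ f) (α : List A) :
    ghost K E e * path K E (E.s f) (f :: α) = 0 := by
  rw [path_cons, ← mul_assoc, ghost_mul_edge_of_ne K E h, zero_mul]

theorem pathStar_cons_mul_edge (e : A) (α : List A) :
    pathStar K E (E.s e) (e :: α) * edge K E e = pathStar K E (E.r e) α := by
  rw [pathStar_cons, mul_assoc, ghost_mul_edge_self, pathStar_mul_vert]

theorem pathStar_cons_mul_edge_of_ne {e f : A} (h : e ≠ f) (α : List A) :
    pathStar K E (E.s f) (f :: α) * edge K E e = 0 := by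
  rw [pathStar_cons, mul_assoc, ghost_mul_edge_of_ne K E h.symm, mul_zero]

end Paths

/-! ### Homogeneous components and their sum. -/

section Components

variable {K : Type*} [Field K] {V A : Type*} [Fintype V] [DecidableEq V] [Fintype A]
  {E : DirGraph V A}

theorem path_mul_pathStar_mem_component {u v w : V} {α β : List A} (hα : E.IsPath u α w)
    (hβ : E.IsPath v β w) {i : ℤ} (hi : (α.length : ℤ) - β.length = i) :
    path K E u α * pathStar K E v β ∈ component K E i :=
  Submodule.subset_span ⟨u, v, w, α, β, hα, hβ, hi, rfl⟩

/-- A linear map that sends the spanning monomials of a component into a submodule sends the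
whole component into it. -/
theorem map_mem_of_mem_component {M : Type*} [AddCommGroup M] [Module K M] {i : ℤ}
    (T : LeavittPathAlgebra K E →ₗ[K] M) (N : Submodule K M)
    (h : ∀ (u v w : V) (α β : List A), E.IsPath u α w → E.IsPath v β w →
      (α.length : ℤ) - β.length = i → T (path K E u α * pathStar K E v β) ∈ N)
    {x : LeavittPathAlgebra K E} (hx : x ∈ component K E i) : T x ∈ N := by
  have : component K E i ≤ N.comap T := by
    refine Submodule.span_le.2 ?_
    rintro _ ⟨u, v, w, α, β, hα, hβ, hi, rfl⟩
    exact h u v w α β hα hβ hi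
  exact this hx

theorem vert_mul_mem_component (v : V) {i : ℤ} {x : LeavittPathAlgebra K E}
    (hx : x ∈ component K E i) : vert K E v * x ∈ component K E i := by
  refine map_mem_of_mem_component (LinearMap.mulLeft K (vert K E v)) _ ?_ hx
  intro u v' w α β hα hβ hi
  rw [LinearMap.mulLeft_apply, ← mul_assoc]
  by_cases h : u = v
  · subst h
    rw [vert_mul_path]
    exact path_mul_pathStar_mem_component hα hβ hi
  · rw [vert_mul_path_of_ne K E h, zero_mul]
    exact zero_mem _

theorem edge_mul_mem_component (e : A) {i : ℤ} {x : LeavittPathAlgebra K E}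
    (hx : x ∈ component K E i) : edge K E e * x ∈ component K E (i + 1) := by
  refine map_mem_of_mem_component (LinearMap.mulLeft K (edge K E e)) _ ?_ hx
  intro u v w α β hα hβ hi
  rw [LinearMap.mulLeft_apply, ← mul_assoc]
  by_cases h : u = E.r e
  · subst h
    rw [← path_cons]
    refine path_mul_pathStar_mem_component hα.cons hβ ?_
    simp
    omega
  · rw [← edge_mul_vert_range, mul_assoc (edge K E e), vert_mul_path_of_ne K E h, mul_zero,
      zero_mul]
    exact zero_mem _

/-- By (CK1), `e*` either cancels the first edge of `α` or kills the monomial; if `α` is trivial,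
`e*` instead lengthens `β` at its start or gives zero. -/
theorem ghost_mul_mem_component (e : A) {i : ℤ} {x : LeavittPathAlgebra K E}
    (hx : x ∈ component K E i) : ghost K E e * x ∈ component K E (i - 1) := by
  refine map_mem_of_mem_component (LinearMap.mulLeft K (ghost K E e)) _ ?_ hx
  intro u v w α β hα hβ hi
  rw [LinearMap.mulLeft_apply, ← mul_assoc]
  cases α with
  | nil =>
    obtain rfl : u = w := hα
    rw [path_nil]
    by_cases h : E.s e = u
    · subst h
      rw [ghost_mul_vert_source, ← pathStar_concat, ← vert_mul_pathStar K hβ.concat, ← path_nil]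
      refine path_mul_pathStar_mem_component (E.isPath_nil _) hβ.concat ?_
      simp at hi ⊢
      omega
    · rw [ghost_mul_vert_of_ne K E h, zero_mul]
      exact zero_mem _
  | cons f α =>
    obtain ⟨rfl, hα⟩ := hα
    by_cases h : e = f
    · subst h
      rw [ghost_mul_path_cons]
      refine path_mul_pathStar_mem_component hα hβ ?_
      simp at hi
      omega
    · rw [ghost_mul_path_cons_of_ne K E h, zero_mul]
      exact zero_mem _

theorem mul_edge_mem_component (e : A) {i : ℤ} {x : LeavittPathAlgebra K E}
    (hx : x ∈ component K E i) : x * edge K E e ∈ component K E (i + 1) := by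
  refine map_mem_of_mem_component (LinearMap.mulRight K (edge K E e)) _ ?_ hx
  intro u v w α β hα hβ hi
  rw [LinearMap.mulRight_apply, mul_assoc]
  cases β with
  | nil =>
    obtain rfl : v = w := hβ
    rw [pathStar_nil]
    by_cases h : E.s e = v
    · subst h
      rw [vert_source_mul_edge, ← path_concat, ← path_mul_vert K hα.concat, ← pathStar_nil]
      refine path_mul_pathStar_mem_component hα.concat (E.isPath_nil _) ?_
      simp at hi ⊢
      omega
    · rw [vert_mul_edge_of_ne K E h, mul_zero]
      exact zero_mem _
  | cons f β =>
    obtain ⟨rfl, hβ⟩ := hβ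
    by_cases h : e = f
    · subst h
      rw [pathStar_cons_mul_edge]
      refine path_mul_pathStar_mem_component hα hβ ?_
      simp at hi
      omega
    · rw [pathStar_cons_mul_edge_of_ne K E h, mul_zero]
      exact zero_mem _

theorem vert_mem_component (v : V) : vert K E v ∈ component K E 0 := by
  rw [← vert_mul_self, ← path_nil]
  -- Both factors of `v * v` have become trivial paths; the second is turned back so that it can
  -- serve as `β*`.
  nth_rw 2 [path_nil]
  rw [← pathStar_nil]
  exact path_mul_pathStar_mem_component (E.isPath_nil v) (E.isPath_nil v) (by simp)

/-- The Leavitt path algebra is the sum of its homogeneous components. -/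
theorem iSup_component : ⨆ i, component K E i = ⊤ := by
  set S := ⨆ i, component K E i with hS
  have hle : ∀ i, component K E i ≤ S := fun i => le_iSup _ i
  -- The sum of the components is a left ideal, as generators shift degrees; it contains `1 = ∑ v`.
  have key : ∀ a : FreeAlgebra K (Gen V A), ∀ x ∈ S, mk K E a * x ∈ S := by
    intro a
    induction a using FreeAlgebra.induction with
    | grade0 k =>
      intro x hx
      rw [AlgHom.commutes, ← Algebra.smul_def]
      exact S.smul_mem k hx
    | grade1 g =>
      intro x hx
      have hT : S ≤ S.comap (LinearMap.mulLeft K (mk K E (FreeAlgebra.ι K g))) := by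
        refine iSup_le fun i y hy => ?_
        cases g with
        | vert v => exact hle _ (vert_mul_mem_component v hy)
        | edge e => exact hle _ (edge_mul_mem_component e hy)
        | ghost e => exact hle _ (ghost_mul_mem_component e hy)
      exact hT hx
    | mul a b ha hb =>
      intro x hx
      rw [map_mul, mul_assoc]
      exact ha _ (hb _ hx)
    | add a b ha hb =>
      intro x hx
      rw [map_add, add_mul]
      exact add_mem (ha _ hx) (hb _ hx)
  refine eq_top_iff.2 fun x _ => ?_
  obtain ⟨a, rfl⟩ : ∃ a, mk K E a = x := RingQuot.mkAlgHom_surjective K _ x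
  rw [← mul_one (mk K E a), ← sum_vert K E]
  exact key a _ (sum_mem fun v _ => hle 0 (vert_mem_component v))

end Components

end LeavittPathAlgebra

end DirGraph

namespace DirGraph

namespace LeavittPathAlgebra

/-! ### The grading, and ideals generated by vertices. -/

section Grading

variable (K : Type*) [Field K] {V A : Type*} [Fintype V] [DecidableEq V] [Fintype A]
  (E : DirGraph V A)

open AddMonoidAlgebra in
/-- The `ℤ`-grading, as a homomorphism to the Laurent polynomials over the algebra. -/
theorem exists_gradingHom :
    ∃ φ : LeavittPathAlgebra K E →ₐ[K] AddMonoidAlgebra (LeavittPathAlgebra K E) ℤ,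
      ∀ i, ∀ x ∈ component K E i, φ x = AddMonoidAlgebra.single i x := by
  -- All defining relations are homogeneous for the degrees 0, 1, -1 of vertices, edges and ghost
  -- edges.
  obtain ⟨φ, hv, he, hg⟩ := exists_lift K E
    (B := AddMonoidAlgebra (LeavittPathAlgebra K E) ℤ)
    (fun v => single 0 (vert K E v)) (fun e => single 1 (edge K E e))
    (fun e => single (-1) (ghost K E e))
    (by rw [one_def, ← sum_vert K E]; exact (map_sum (singleAddHom (0 : ℤ)) _ _).symm)
    (fun v => by simp only [single_mul_single, add_zero, vert_mul_self])
    (fun v w h => by simp only [single_mul_single, vert_mul_vert_of_ne K E h, single_zero])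
    (fun e => by simp only [single_mul_single, add_zero, edge_mul_vert_range])
    (fun e => by simp only [single_mul_single, zero_add, vert_source_mul_edge])
    (fun e => by simp only [single_mul_single, add_zero, ghost_mul_vert_source])
    (fun e => by simp only [single_mul_single, zero_add, vert_range_mul_ghost])
    (fun e => by simp only [single_mul_single, neg_add_cancel, ghost_mul_edge_self])
    (fun e f h => by simp only [single_mul_single, ghost_mul_edge_of_ne K E h, single_zero])
    (fun v h => by
      simp only [single_mul_single, add_neg_cancel]
      rw [vert_eq_sum_edge_mul_ghost K E v h]
      exact map_sum (singleAddHom (0 : ℤ)) _ _)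
  have hpath : ∀ (u w : V) (α : List A), E.IsPath u α w →
      φ (path K E u α) = single (α.length : ℤ) (path K E u α) := by
    intro u w α h
    induction α generalizing u with
    | nil => simp [path_nil, hv]
    | cons e α ih =>
      obtain ⟨rfl, h⟩ := h
      rw [path_cons, map_mul, he, ih _ h, single_mul_single, List.length_cons]
      congr 1
      push_cast
      ring
  have hpathStar : ∀ (u w : V) (α : List A), E.IsPath u α w →
      φ (pathStar K E u α) = single (-(α.length : ℤ)) (pathStar K E u α) := by
    intro u w α h
    induction α generalizing u with
    | nil => simp [pathStar_nil, hv]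
    | cons e α ih =>
      obtain ⟨rfl, h⟩ := h
      rw [pathStar_cons, map_mul, hg, ih _ h, single_mul_single, List.length_cons]
      congr 1
      push_cast
      ring
  refine ⟨φ, fun i x hx => ?_⟩
  induction hx using Submodule.span_induction with
  | mem x h =>
    obtain ⟨u, v, w, α, β, hα, hβ, rfl, rfl⟩ := h
    rw [map_mul, hpath _ _ _ hα, hpathStar _ _ _ hβ, single_mul_single, sub_eq_add_neg]
  | zero => simp
  | add x y _ _ hx hy => rw [map_add, hx, hy, single_add]
  | smul k x _ hx => rw [map_smul, hx, smul_single]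

/-- An ideal generated by vertices is graded. -/
theorem isGraded_idealOf (H : Set V) : IsGraded (idealOf K E H) := by
  obtain ⟨φ, hφ⟩ := exists_gradingHom K E
  let I := idealOf K E H
  -- With coefficients reduced modulo `I`, the grading map kills `H`, hence `I`; the coefficient at
  -- `i` of the image of `∑ yⱼ` is the class of `yᵢ`.
  let q := AddMonoidAlgebra.mapRingHom ℤ I.ringCon.mk'
  let ψ : LeavittPathAlgebra K E →+* AddMonoidAlgebra I.ringCon.Quotient ℤ :=
    q.comp φ.toRingHom
  have hmk : ∀ x, I.ringCon.mk' x = 0 ↔ x ∈ I := fun x => by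
    rw [← TwoSidedIdeal.mem_ker, TwoSidedIdeal.ker_ringCon_mk']
  have hψ : ∀ i, ∀ x ∈ component K E i, ψ x = AddMonoidAlgebra.single i (I.ringCon.mk' x) := by
    intro i x hx
    change q (φ x) = _
    rw [hφ i x hx]
    exact AddMonoidAlgebra.mapRingHom_single ..
  have hle : I ≤ TwoSidedIdeal.ker ψ := by
    refine TwoSidedIdeal.span_le.2 ?_
    rintro _ ⟨v, hv, rfl⟩
    rw [SetLike.mem_coe, TwoSidedIdeal.mem_ker, hψ 0 _ (vert_mem_component v),
      (hmk _).2 (TwoSidedIdeal.subset_span ⟨v, hv, rfl⟩), AddMonoidAlgebra.single_zero]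
  intro y hy hmem i
  have h0 := (TwoSidedIdeal.mem_ker ψ).1 (hle hmem)
  rw [Finsupp.sum, map_sum, Finset.sum_congr rfl fun j _ => hψ j _ (hy j)] at h0
  have h1 := congrArg (fun p => p.coeff i) h0
  rw [← hmk]
  by_cases hi : i ∈ y.support
  · simpa [-LaurentPolynomial.single_eq_C_mul_T,
      AddMonoidAlgebra.coeff_sum, Finsupp.single_apply, hi] using h1
  · rw [Finsupp.notMem_support_iff.1 hi, map_zero]

end Grading

end LeavittPathAlgebra

end DirGraph

namespace DirGraph

namespace LeavittPathAlgebra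

/-! ### Branching systems and the vertices of the ideal generated by `H`. -/

section Representation

variable (K : Type*) [Field K] {V A : Type*} [Fintype V] [DecidableEq V] [Fintype A]
  (E : DirGraph V A)

open Classical in
/-- A branching system: `P` is fibred over the vertices by `π`, each edge `e` maps the fibre over
its range injectively into the fibre over its source by `σ e`, and the fibre over a vertex that
emits edges is the disjoint union of the images of these maps, as recorded by `D`. It gives a
representation of the Leavitt path algebra on the functions on `P`. -/
theorem exists_representation {P : Type*} (π : P → V) (σ : A → P → P) (D : P → Option (A × P))
    (hD : ∀ p e q, D p = some (e, q) → E.s e = π p ∧ E.r e = π q ∧ σ e q = p)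
    (hσ : ∀ e q, π q = E.r e → D (σ e q) = some (e, q))
    (hne : ∀ p, (∃ e, E.s e = π p) → ∃ e q, D p = some (e, q)) :
    ∃ φ : LeavittPathAlgebra K E →ₐ[K] Module.End K (P → K),
      ∀ v f p, φ (vert K E v) f p = if π p = v then f p else 0 := by
  let a : V → Module.End K (P → K) := fun v =>
    { toFun := fun f p => if π p = v then f p else 0
      map_add' := fun f g => by ext p; by_cases h : π p = v <;> simp [h]
      map_smul' := fun k f => by ext p; by_cases h : π p = v <;> simp [h] }
  -- An edge acts by transport along `σ e`, extended by zero off its image; its ghost, `c e` below,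
  -- acts by pullback along `σ e`.
  let b : A → Module.End K (P → K) := fun e =>
    { toFun := fun f p => (D p).elim 0 fun x => if x.1 = e then f x.2 else 0
      map_add' := fun f g => by
        ext p
        rcases h : D p with _ | ⟨e', q⟩
        · simp [h]
        · by_cases he : e' = e <;> simp [h, he]
      map_smul' := fun k f => by
        ext p
        rcases h : D p with _ | ⟨e', q⟩
        · simp [h]
        · by_cases he : e' = e <;> simp [h, he] }
  let c : A → Module.End K (P → K) := fun e =>
    { toFun := fun f q => if π q = E.r e then f (σ e q) else 0
      map_add' := fun f g => by ext p; by_cases h : π p = E.r e <;> simp [h]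
      map_smul' := fun k f => by ext p; by_cases h : π p = E.r e <;> simp [h] }
  have ha : ∀ v f p, a v f p = if π p = v then f p else 0 := fun _ _ _ => rfl
  have hb : ∀ e f p, b e f p = (D p).elim 0 fun x => if x.1 = e then f x.2 else 0 :=
    fun _ _ _ => rfl
  have hc : ∀ e f q, c e f q = if π q = E.r e then f (σ e q) else 0 := fun _ _ _ => rfl
  have hπσ : ∀ e q, π q = E.r e → π (σ e q) = E.s e := fun e q h => (hD _ _ _ (hσ e q h)).1.symm
  refine (exists_lift K E a b c ?_ ?_ ?_ ?_ ?_ ?_ ?_ ?_ ?_ ?_).imp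
    fun φ hφ v f p => by rw [hφ.1, ha]
  · refine LinearMap.ext fun f => funext fun p => ?_
    simp [LinearMap.sum_apply, ha]
  · intro v
    refine LinearMap.ext fun f => funext fun p => ?_
    by_cases h : π p = v <;> simp [ha, h]
  · intro v w hvw
    refine LinearMap.ext fun f => funext fun p => ?_
    by_cases h : π p = v <;> simp [ha, h, hvw.symm]
  · intro e
    refine LinearMap.ext fun f => funext fun p => ?_
    rw [Module.End.mul_apply, hb, hb]
    rcases h : D p with _ | ⟨e', q⟩
    · rfl
    · by_cases he : e' = e
      · subst he
        simp [ha, (hD _ _ _ h).2.1]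
      · simp [he]
  · intro e
    refine LinearMap.ext fun f => funext fun p => ?_
    rw [Module.End.mul_apply, ha, hb]
    rcases h : D p with _ | ⟨e', q⟩
    · simp
    · by_cases he : e' = e
      · subst he
        simp [(hD _ _ _ h).1]
      · simp [he]
  · intro e
    refine LinearMap.ext fun f => funext fun p => ?_
    by_cases h : π p = E.r e <;> simp [hc, ha, h, hπσ]
  · intro e
    refine LinearMap.ext fun f => funext fun p => ?_
    by_cases h : π p = E.r e <;> simp [hc, ha, h]
  · intro e
    refine LinearMap.ext fun f => funext fun p => ?_
    by_cases h : π p = E.r e <;> simp [hc, hb, ha, h, hσ]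
  · intro e f hef
    refine LinearMap.ext fun g => funext fun p => ?_
    by_cases h : π p = E.r e <;> simp [hc, hb, h, hσ, hef]
  · intro v hv
    refine LinearMap.ext fun f => funext fun p => ?_
    rw [LinearMap.sum_apply, Finset.sum_apply, ha]
    simp only [Module.End.mul_apply, hb]
    by_cases h : π p = v
    · obtain ⟨e, q, hp⟩ := hne p (h ▸ hv)
      obtain ⟨h1, h2, h3⟩ := hD _ _ _ hp
      -- The point `p` lies in the image of exactly one `σ e`, so one summand of (CK2) survives.
      rw [if_pos h, hp, Finset.sum_eq_single_of_mem e (by simp [h1, h])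
        (fun e' _ he' => by simp [he'.symm])]
      simp [hc, h2, h3]
    · rw [if_neg h]
      symm
      refine Finset.sum_eq_zero fun e he => ?_
      rcases hp : D p with _ | ⟨e', q⟩
      · rfl
      · have : e' ≠ e := by
          rintro rfl
          exact h ((hD _ _ _ hp).1.symm.trans (Finset.mem_filter.1 he).2)
        simp [this]

variable {E} in
open Classical in
/-- The vertices of the ideal generated by a hereditary saturated set all lie in that set. -/
theorem mem_of_vert_mem_idealOf {H : Set V} (hH : E.Hereditary H) (hS : E.Saturated H) {v : V}
    (hv : vert K E v ∈ idealOf K E H) : v ∈ H := by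
  -- Heredity: an edge ending outside `H` starts outside `H`, so `σ e` has a fibre to land in.
  have hsr : ∀ e, E.r e ∉ H → E.s e ∉ H := fun e he hs =>
    he (hH _ _ hs ⟨[e], rfl, rfl⟩)
  let S : V → Type _ := fun v => {e : A // E.s e = v ∧ E.r e ∉ H}
  -- Saturation: a vertex outside `H` that emits edges emits one that ends outside `H`. Then `S v ×
  -- ℕ` is countably infinite, and the fibre `ℕ` over `v` splits into one full copy of `ℕ` for each
  -- such edge.
  have hΦ : ∀ v, v ∉ H → (∃ e, E.s e = v) → Nonempty (ℕ ≃ S v × ℕ) := by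
    intro v hv he
    have : Nonempty (S v) := by
      by_contra hn
      exact hv (hS v he fun e hev => by_contra fun her => hn ⟨⟨e, hev, her⟩⟩)
    exact nonempty_equiv_of_countable
  let Φ : ∀ v, v ∉ H → (∃ e, E.s e = v) → (ℕ ≃ S v × ℕ) :=
    fun v hv he => Classical.choice (hΦ v hv he)
  let P := {v : V // v ∉ H} × ℕ
  let π : P → V := fun p => p.1
  let σ : A → P → P := fun e q =>
    if h : E.r e ∉ H then
      (⟨E.s e, hsr e h⟩, (Φ (E.s e) (hsr e h) ⟨e, rfl⟩).symm (⟨e, rfl, h⟩, q.2))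
    -- A junk value: a point over `E.r e` exists only if `E.r e ∉ H`.
    else q
  let D : P → Option (A × P) := fun p =>
    if h : ∃ e, E.s e = p.1 then
      let x := Φ p.1 p.1.2 h p.2
      some (x.1.1, ⟨E.r x.1.1, x.1.2.2⟩, x.2)
    else none
  refine (exists_representation K E π σ D ?_ ?_ ?_).elim fun φ hφ => ?_
  rotate_right
  · by_contra hvH
    have hle : idealOf K E H ≤ TwoSidedIdeal.ker φ := by
      refine TwoSidedIdeal.span_le.2 ?_
      rintro _ ⟨w, hw, rfl⟩
      refine (TwoSidedIdeal.mem_ker φ).2 (LinearMap.ext fun f => funext fun p => ?_)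
      rw [hφ, if_neg fun h : (p.1 : V) = w => p.1.2 (h ▸ hw)]
      rfl
    have h0 := (TwoSidedIdeal.mem_ker φ).1 (hle hv)
    -- If `v ∉ H`, its fibre is nonempty and `v` fixes the value there of the constant function 1.
    have h1 := hφ v (fun _ => 1) (⟨v, hvH⟩, 0)
    rw [h0, if_pos rfl] at h1
    exact zero_ne_one h1
  · rintro ⟨⟨v, hv⟩, m⟩ e q h
    by_cases hs : ∃ e, E.s e = v
    · simp only [D, dif_pos hs, Option.some.injEq, Prod.mk.injEq] at h
      obtain ⟨rfl, rfl⟩ := h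
      refine ⟨(Φ v hv hs m).1.2.1, rfl, ?_⟩
      simp only [σ, dif_pos (Φ v hv hs m).1.2.2]
      -- `Φ` depends on the vertex, and the source of the chosen edge equals `v` only
      -- propositionally; for a general `x` that equality can be eliminated.
      have key : ∀ (x : S v × ℕ) (hx : E.s x.1.1 ∉ H) (hs' : ∃ e, E.s e = E.s x.1.1),
          (Φ (E.s x.1.1) hx hs').symm (⟨x.1.1, rfl, x.1.2.2⟩, x.2) = (Φ v hv hs).symm x := by
        rintro ⟨⟨e, rfl, he⟩, n⟩ hx hs'
        rfl
      refine Prod.ext (Subtype.ext (Φ v hv hs m).1.2.1) ?_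
      exact (key _ (hsr _ (Φ v hv hs m).1.2.2) ⟨_, rfl⟩).trans (Equiv.symm_apply_apply _ _)
    · simp [D, dif_neg hs] at h
  · rintro e ⟨⟨v, hv⟩, n⟩ h
    obtain rfl : v = E.r e := h
    simp only [σ, D, dif_pos hv]
    rw [dif_pos ⟨e, rfl⟩]
    simp
  · rintro ⟨⟨v, hv⟩, m⟩ h
    exact ⟨_, _, dif_pos h⟩

end Representation

end LeavittPathAlgebra

end DirGraph

namespace DirGraph

namespace LeavittPathAlgebra

/-! ### Reduction of homogeneous elements to vertices. -/

section Reduction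

variable {K : Type*} [Field K] {V A : Type*} [Fintype V] [DecidableEq V] [Fintype A]
  {E : DirGraph V A}

variable (K E) in
/-- The span of the elements `αβ*` with `α`, `β` paths of the same range and of the same
length, at most `N`. -/
noncomputable def balanced (N : ℕ) : Submodule K (LeavittPathAlgebra K E) :=
  Submodule.span K {x | ∃ (u v w : V) (α β : List A), E.IsPath u α w ∧ E.IsPath v β w ∧
    α.length = β.length ∧ α.length ≤ N ∧ x = path K E u α * pathStar K E v β}

theorem balanced_mono : Monotone (balanced K E) := by
  intro M N h
  refine Submodule.span_mono ?_
  rintro x ⟨u, v, w, α, β, hα, hβ, hl, hN, rfl⟩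
  exact ⟨u, v, w, α, β, hα, hβ, hl, hN.trans h, rfl⟩

theorem exists_mem_balanced {x : LeavittPathAlgebra K E} (hx : x ∈ component K E 0) :
    ∃ N, x ∈ balanced K E N := by
  induction hx using Submodule.span_induction with
  | mem x h =>
    obtain ⟨u, v, w, α, β, hα, hβ, hl, rfl⟩ := h
    exact ⟨α.length, Submodule.subset_span ⟨u, v, w, α, β, hα, hβ, by omega, le_rfl, rfl⟩⟩
  | zero => exact ⟨0, zero_mem _⟩
  | add x y _ _ hx hy =>
    obtain ⟨M, hM⟩ := hx
    obtain ⟨N, hN⟩ := hy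
    exact ⟨max M N, add_mem (balanced_mono (le_max_left M N) hM)
      (balanced_mono (le_max_right M N) hN)⟩
  | smul k x _ hx =>
    obtain ⟨N, hN⟩ := hx
    exact ⟨N, Submodule.smul_mem _ k hN⟩

theorem map_mem_of_mem_balanced {M : Type*} [AddCommGroup M] [Module K M] {N : ℕ}
    (T : LeavittPathAlgebra K E →ₗ[K] M) (P : Submodule K M)
    (h : ∀ (u v w : V) (α β : List A), E.IsPath u α w → E.IsPath v β w →
      α.length = β.length → α.length ≤ N → T (path K E u α * pathStar K E v β) ∈ P)
    {x : LeavittPathAlgebra K E} (hx : x ∈ balanced K E N) : T x ∈ P := by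
  have : balanced K E N ≤ P.comap T := by
    refine Submodule.span_le.2 ?_
    rintro _ ⟨u, v, w, α, β, hα, hβ, hl, hN, rfl⟩
    exact h u v w α β hα hβ hl hN
  exact this hx

/-- Each factor strips one edge by (CK1) or gives zero. If both paths are trivial, the product is
`r(e)` or zero, which still has length 0. -/
theorem ghost_mul_mul_edge_mem_balanced (e f : A) {N : ℕ} {x : LeavittPathAlgebra K E}
    (hx : x ∈ balanced K E (N + 1)) : ghost K E e * x * edge K E f ∈ balanced K E N := by
  refine map_mem_of_mem_balanced
    (LinearMap.mulRight K (edge K E f) ∘ₗ LinearMap.mulLeft K (ghost K E e)) _ ?_ hx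
  intro u v w α β hα hβ hl hN
  simp only [LinearMap.comp_apply, LinearMap.mulLeft_apply, LinearMap.mulRight_apply]
  rw [← mul_assoc, mul_assoc]
  rcases α with _ | ⟨a, α⟩ <;> rcases β with _ | ⟨b, β⟩
  · obtain rfl : u = w := hα
    obtain rfl : v = u := hβ
    rw [path_nil, pathStar_nil]
    by_cases he : E.s e = v
    · rw [← he, ghost_mul_vert_source, ← mul_assoc, ghost_mul_vert_source]
      by_cases hef : e = f
      · subst hef
        rw [ghost_mul_edge_self, ← vert_mul_self, ← path_nil]
        nth_rw 2 [path_nil]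
        rw [← pathStar_nil]
        exact Submodule.subset_span ⟨_, _, _, [], [], E.isPath_nil _, E.isPath_nil _, rfl,
          Nat.zero_le _, rfl⟩
      · rw [ghost_mul_edge_of_ne K E hef]
        exact zero_mem _
    · rw [ghost_mul_vert_of_ne K E he, zero_mul]
      exact zero_mem _
  · simp at hl
  · simp at hl
  · obtain ⟨rfl, hα⟩ := hα
    obtain ⟨rfl, hβ⟩ := hβ
    by_cases ha : e = a
    · by_cases hb : f = b
      · subst ha hb
        rw [ghost_mul_path_cons, pathStar_cons_mul_edge]
        exact Submodule.subset_span ⟨_, _, _, α, β, hα, hβ, by simpa using hl,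
          by simpa using hN, rfl⟩
      · rw [pathStar_cons_mul_edge_of_ne K E hb, mul_zero]
        exact zero_mem _
    · rw [ghost_mul_path_cons_of_ne K E ha, zero_mul]
      exact zero_mem _

/-- Either alternative leaves only trivial `α` starting at `v`, and equal lengths then make `β`
trivial. -/
theorem vert_mul_mem_span {N : ℕ} {v : V} (h : N = 0 ∨ ¬∃ e, E.s e = v)
    {x : LeavittPathAlgebra K E} (hx : x ∈ balanced K E N) :
    vert K E v * x ∈ Submodule.span K {vert K E v} := by
  refine map_mem_of_mem_balanced (LinearMap.mulLeft K (vert K E v)) _ ?_ hx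
  intro u v' w α β hα hβ hl hN
  rw [LinearMap.mulLeft_apply, ← mul_assoc]
  by_cases hu : u = v
  · subst hu
    rcases α with _ | ⟨a, α⟩
    · obtain rfl := List.length_eq_zero_iff.1 hl.symm
      obtain rfl : u = w := hα
      obtain rfl : v' = u := hβ
      rw [path_nil, pathStar_nil, vert_mul_self, vert_mul_self]
      exact Submodule.mem_span_singleton_self _
    · rcases h with rfl | h
      · simp at hN
      · exact absurd ⟨a, hα.1⟩ h
  · rw [vert_mul_path_of_ne K E hu, zero_mul]
    exact zero_mem _

theorem mul_vert_mem_span {N : ℕ} {v : V} (h : ¬∃ e, E.s e = v)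
    {x : LeavittPathAlgebra K E} (hx : x ∈ balanced K E N) :
    x * vert K E v ∈ Submodule.span K {vert K E v} := by
  refine map_mem_of_mem_balanced (LinearMap.mulRight K (vert K E v)) _ ?_ hx
  intro u v' w α β hα hβ hl hN
  rw [LinearMap.mulRight_apply, mul_assoc]
  by_cases hu : v' = v
  · subst hu
    rcases β with _ | ⟨b, β⟩
    · obtain rfl := List.length_eq_zero_iff.1 hl
      obtain rfl : u = w := hα
      obtain rfl : v' = u := hβ
      rw [path_nil, pathStar_nil, vert_mul_self, vert_mul_self]
      exact Submodule.mem_span_singleton_self _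
    · exact absurd ⟨b, hβ.1⟩ h
  · rw [pathStar_mul_vert_of_ne K E hu, mul_zero]
    exact zero_mem _

/-- A nonzero scalar is invertible, so a nonzero multiple of `v` in `I` puts `v` itself in `I`. -/
theorem mem_of_mem_span_vert {I J : TwoSidedIdeal (LeavittPathAlgebra K E)}
    (hIJ : ∀ v, vert K E v ∈ I → vert K E v ∈ J) {v : V} {x : LeavittPathAlgebra K E}
    (hx : x ∈ Submodule.span K {vert K E v}) (hI : x ∈ I) : x ∈ J := by
  obtain ⟨k, rfl⟩ := Submodule.mem_span_singleton.1 hx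
  by_cases hk : k = 0
  · rw [hk, zero_smul]
    exact J.zero_mem
  · rw [Algebra.smul_def]
    refine J.mul_mem_left _ _ (hIJ v ?_)
    have := I.mul_mem_left (algebraMap K _ k⁻¹) _ hI
    rwa [← Algebra.smul_def, inv_smul_smul₀ hk] at this

theorem mem_of_vert_mul_mem {J : TwoSidedIdeal (LeavittPathAlgebra K E)}
    {x : LeavittPathAlgebra K E} (h : ∀ v, vert K E v * x ∈ J) : x ∈ J := by
  rw [← one_mul x, ← sum_vert K E, Finset.sum_mul]
  exact sum_mem fun v _ => h v

theorem mem_of_mul_vert_mem {J : TwoSidedIdeal (LeavittPathAlgebra K E)}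
    {x : LeavittPathAlgebra K E} (h : ∀ v, x * vert K E v ∈ J) : x ∈ J := by
  rw [← mul_one x, ← sum_vert K E, Finset.mul_sum]
  exact sum_mem fun v _ => h v

/-- By (CK2), `vx = ∑ e(e*x)`: this undoes multiplication by ghost edges. -/
theorem vert_mul_mem_of_ghost_mul_mem {J : TwoSidedIdeal (LeavittPathAlgebra K E)}
    {x : LeavittPathAlgebra K E} {v : V} (hv : ∃ e, E.s e = v)
    (h : ∀ e, ghost K E e * x ∈ J) : vert K E v * x ∈ J := by
  rw [vert_eq_sum_edge_mul_ghost K E v hv, Finset.sum_mul]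
  refine sum_mem fun e _ => ?_
  rw [mul_assoc]
  exact J.mul_mem_left _ _ (h e)

theorem mul_vert_mem_of_mul_edge_mem {J : TwoSidedIdeal (LeavittPathAlgebra K E)}
    {x : LeavittPathAlgebra K E} {v : V} (hv : ∃ e, E.s e = v)
    (h : ∀ e, x * edge K E e ∈ J) : x * vert K E v ∈ J := by
  rw [vert_eq_sum_edge_mul_ghost K E v hv, Finset.mul_sum]
  refine sum_mem fun e _ => ?_
  rw [← mul_assoc]
  exact J.mul_mem_right _ _ (h e)

/-- Induction on the length bound: the elements `e*xf` lie one level lower and stay in `I`, and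
(CK2) on both sides rebuilds `x`. -/
theorem mem_of_mem_balanced {I J : TwoSidedIdeal (LeavittPathAlgebra K E)}
    (hIJ : ∀ v, vert K E v ∈ I → vert K E v ∈ J) {N : ℕ} {x : LeavittPathAlgebra K E}
    (hx : x ∈ balanced K E N) (hI : x ∈ I) : x ∈ J := by
  induction N generalizing x with
  | zero =>
    exact mem_of_vert_mul_mem fun v => mem_of_mem_span_vert hIJ
      (vert_mul_mem_span (Or.inl rfl) hx) (I.mul_mem_left _ _ hI)
  | succ N ih =>
    refine mem_of_vert_mul_mem fun v => ?_
    by_cases hv : ∃ e, E.s e = v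
    · refine vert_mul_mem_of_ghost_mul_mem hv fun e => mem_of_mul_vert_mem fun w => ?_
      by_cases hw : ∃ f, E.s f = w
      · exact mul_vert_mem_of_mul_edge_mem hw fun f =>
          ih (ghost_mul_mul_edge_mem_balanced e f hx)
            (I.mul_mem_right _ _ (I.mul_mem_left _ _ hI))
      -- At a sink `w` no induction is needed: `xw` is already a multiple of `w`, whatever the
      -- length bound.
      · rw [mul_assoc]
        exact J.mul_mem_left _ _ (mem_of_mem_span_vert hIJ (mul_vert_mem_span hw hx)
          (I.mul_mem_right _ _ hI))
    · exact mem_of_mem_span_vert hIJ (vert_mul_mem_span (Or.inr hv) hx) (I.mul_mem_left _ _ hI)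

/-- A monomial of positive degree begins with an edge, and a sink emits none. -/
theorem vert_mul_eq_zero {v : V} (hv : ¬∃ e, E.s e = v) {i : ℤ} (hi : 0 < i)
    {x : LeavittPathAlgebra K E} (hx : x ∈ component K E i) : vert K E v * x = 0 := by
  refine (Submodule.mem_bot K).1
    (map_mem_of_mem_component (LinearMap.mulLeft K (vert K E v)) ⊥ ?_ hx)
  intro u v' w α β hα hβ hl
  rw [LinearMap.mulLeft_apply, Submodule.mem_bot, ← mul_assoc]
  rcases α with _ | ⟨a, α⟩
  · simp at hl
    omega
  · rw [vert_mul_path_of_ne K E (fun h => hv ⟨a, hα.1.trans h⟩), zero_mul]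

theorem mul_vert_eq_zero {v : V} (hv : ¬∃ e, E.s e = v) {i : ℤ} (hi : i < 0)
    {x : LeavittPathAlgebra K E} (hx : x ∈ component K E i) : x * vert K E v = 0 := by
  refine (Submodule.mem_bot K).1
    (map_mem_of_mem_component (LinearMap.mulRight K (vert K E v)) ⊥ ?_ hx)
  intro u v' w α β hα hβ hl
  rw [LinearMap.mulRight_apply, Submodule.mem_bot, mul_assoc]
  rcases β with _ | ⟨b, β⟩
  · simp at hl
    omega
  · rw [pathStar_mul_vert_of_ne K E (fun h => hv ⟨b, hβ.1.trans h⟩), mul_zero]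

/-- A homogeneous element of an ideal lies in every ideal that contains its vertices. -/
theorem mem_of_mem_component {I J : TwoSidedIdeal (LeavittPathAlgebra K E)}
    (hIJ : ∀ v, vert K E v ∈ I → vert K E v ∈ J) {i : ℤ} {x : LeavittPathAlgebra K E}
    (hx : x ∈ component K E i) (hI : x ∈ I) : x ∈ J := by
  induction i using Int.induction_on generalizing x with
  | zero =>
    obtain ⟨N, hN⟩ := exists_mem_balanced hx
    exact mem_of_mem_balanced hIJ hN hI
  -- Positive degrees are lowered by ghost edges on the left, the side where a sink annihilates `x`.
  | succ n ih =>
    refine mem_of_vert_mul_mem fun v => ?_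
    by_cases hv : ∃ e, E.s e = v
    · refine vert_mul_mem_of_ghost_mul_mem hv fun e => ih ?_ (I.mul_mem_left _ _ hI)
      simpa using ghost_mul_mem_component e hx
    · rw [vert_mul_eq_zero hv (by omega) hx]
      exact J.zero_mem
  -- In negative degrees it is `β` that is nontrivial, so the degree is raised by edges on the
  -- right.
  | pred n ih =>
    refine mem_of_mul_vert_mem fun v => ?_
    by_cases hv : ∃ e, E.s e = v
    · refine mul_vert_mem_of_mul_edge_mem hv fun e => ih ?_ (I.mul_mem_right _ _ hI)
      simpa using mul_edge_mem_component e hx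
    · rw [mul_vert_eq_zero hv (by omega) hx]
      exact J.zero_mem

/-- A graded ideal lies in every ideal that contains its vertices. -/
theorem IsGraded.le_of_vertices {I J : TwoSidedIdeal (LeavittPathAlgebra K E)}
    (hI : IsGraded I) (hIJ : ∀ v, vert K E v ∈ I → vert K E v ∈ J) : I ≤ J := by
  intro x hx
  have hmem : x ∈ ⨆ i, component K E i := by
    rw [iSup_component]
    exact Submodule.mem_top
  obtain ⟨y, hy, rfl⟩ := (Submodule.mem_iSup_iff_exists_finsupp _ _).1 hmem
  exact sum_mem fun i _ => mem_of_mem_component hIJ (hy i) (hI y hy hx i)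

end Reduction

/-! ### The vertices of an ideal. -/

section Vertices

variable {K : Type*} [Field K] {V A : Type*} [Fintype V] [DecidableEq V] [Fintype A]
  {E : DirGraph V A}

/-- For one edge, `r(e) = e* s(e) e`; a path follows edge by edge. -/
theorem hereditary_vertices (I : TwoSidedIdeal (LeavittPathAlgebra K E)) :
    E.Hereditary (vertices I) := by
  rintro v w hv ⟨μ, hμ⟩
  induction μ generalizing v with
  | nil =>
    obtain rfl : v = w := hμ
    exact hv
  | cons e μ ih =>
    obtain ⟨rfl, hμ⟩ := hμ
    refine ih (E.r e) ?_ hμ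
    change vert K E (E.r e) ∈ I
    rw [← ghost_mul_edge_self, ← vert_source_mul_edge]
    exact I.mul_mem_left _ _ (I.mul_mem_right _ _ hv)

/-- By (CK2), `v = ∑ e r(e) e*`. -/
theorem saturated_vertices (I : TwoSidedIdeal (LeavittPathAlgebra K E)) :
    E.Saturated (vertices I) := by
  intro v hv h
  change vert K E v ∈ I
  rw [vert_eq_sum_edge_mul_ghost K E v hv]
  refine sum_mem fun e he => ?_
  rw [← edge_mul_vert_range]
  exact I.mul_mem_right _ _ (I.mul_mem_left _ _ (h e (Finset.mem_filter.1 he).2))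

end Vertices

end LeavittPathAlgebra

end DirGraph

/-! ### The bijection. -/

theorem corollary3p2 (K : Type*) [Field K] {V A : Type*} [Fintype V] [DecidableEq V] [Fintype A]
    (E : DirGraph V A) :
    Set.BijOn DirGraph.LeavittPathAlgebra.vertices
        {I : TwoSidedIdeal (DirGraph.LeavittPathAlgebra K E) |
          DirGraph.LeavittPathAlgebra.IsGraded I}
        {H : Set V | E.Hereditary H ∧ E.Saturated H} ∧
      Set.BijOn (DirGraph.LeavittPathAlgebra.idealOf K E)
        {H : Set V | E.Hereditary H ∧ E.Saturated H}
        {I : TwoSidedIdeal (DirGraph.LeavittPathAlgebra K E) |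
          DirGraph.LeavittPathAlgebra.IsGraded I} ∧
      Set.InvOn (DirGraph.LeavittPathAlgebra.idealOf K E) DirGraph.LeavittPathAlgebra.vertices
        {I : TwoSidedIdeal (DirGraph.LeavittPathAlgebra K E) |
          DirGraph.LeavittPathAlgebra.IsGraded I}
        {H : Set V | E.Hereditary H ∧ E.Saturated H} := by
  have hinv : Set.InvOn (DirGraph.LeavittPathAlgebra.idealOf K E)
      DirGraph.LeavittPathAlgebra.vertices
      {I : TwoSidedIdeal (DirGraph.LeavittPathAlgebra K E) |
        DirGraph.LeavittPathAlgebra.IsGraded I}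
      {H : Set V | E.Hereditary H ∧ E.Saturated H} := by
    constructor
    · intro I hI
      refine le_antisymm (TwoSidedIdeal.span_le.2 ?_)
        (DirGraph.LeavittPathAlgebra.IsGraded.le_of_vertices hI fun v hv =>
          TwoSidedIdeal.subset_span ⟨v, hv, rfl⟩)
      rintro _ ⟨v, hv, rfl⟩
      exact hv
    · rintro H ⟨hH, hS⟩
      exact Set.Subset.antisymm
        (fun v hv => DirGraph.LeavittPathAlgebra.mem_of_vert_mem_idealOf K hH hS hv)
        (fun v hv => TwoSidedIdeal.subset_span ⟨v, hv, rfl⟩)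
  have hmaps : Set.MapsTo DirGraph.LeavittPathAlgebra.vertices
      {I : TwoSidedIdeal (DirGraph.LeavittPathAlgebra K E) |
        DirGraph.LeavittPathAlgebra.IsGraded I}
      {H : Set V | E.Hereditary H ∧ E.Saturated H} := fun I _ =>
    ⟨DirGraph.LeavittPathAlgebra.hereditary_vertices I,
      DirGraph.LeavittPathAlgebra.saturated_vertices I⟩
  have hmaps' : Set.MapsTo (DirGraph.LeavittPathAlgebra.idealOf K E)
      {H : Set V | E.Hereditary H ∧ E.Saturated H}
      {I : TwoSidedIdeal (DirGraph.LeavittPathAlgebra K E) |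
        DirGraph.LeavittPathAlgebra.IsGraded I} := fun H _ =>
    DirGraph.LeavittPathAlgebra.isGraded_idealOf K E H
  exact ⟨hinv.bijOn hmaps hmaps', hinv.symm.bijOn hmaps' hmaps, hinv⟩
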